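/- Let $X$ be a scheme, and fix a universe containing $X$; all schemes and sets below belong to it. Let $(\mathrm{Zar}/X)$ be the ordered set of open subschemes $V\subset X$, with the usual coverings $V=\bigcup_\lambda V_\lambda$. Let $(\mathrm{fppf}/X)$ be the category of $X$-schemes $(U,p)$ whose structure morphism $p:U\to X$ is flat and locally of finite presentation, with arbitrary $X$-morphisms; its covering families are the jointly surjective families $(U_\alpha\to U)_\alpha$ of flat $X$-morphisms. Let $X_{\mathrm{Zar}}$ and $X_{\mathrm{fppf}}$ be the resulting topoi of sheaves of sets. Let $$u:(\mathrm{fppf}/X)\to(\mathrm{Zar}/X),\quad (U,p)\mapsto p(U),\qquad v:(\mathrm{Zar}/X)\to(\mathrm{fppf}/X),\quad V\mapsto (V,i),$$ where $i:V\to X$ is the inclusion. For a topos $\mathcal E$ let $\mathrm{Loc}(\mathcal E)$ be the ordered set of subobjects of the terminal object. A continuous map of topoi $\mathcal E\to\mathcal E'$ is a pair $(\epsilon_*,\epsilon^{-1})$ of functors with $\epsilon^{-1}$ left exact and left adjoint to $\epsilon_*$. Let $|\mathcal E|$ be the set of isomorphism classes of points, that is, of continuous maps $P:(\mathrm{Set})\to\mathcal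 E$, with the topology given by the sets $\{[P] : P^{-1}(G)\neq\varnothing\}$ for $G\in\mathrm{Loc}(\mathcal E)$, and let $|\mathcal E|_{\mathrm{sob}}$ be its sobrification. Then the following hold. (a) The functor $u$ is left adjoint to $v$, and: (TL 1) $u\circ v$ is isomorphic to the identity functor of $(\mathrm{Zar}/X)$. (TL 2) For each covering family $(V_\lambda\to V)_\lambda$ in $(\mathrm{Zar}/X)$, the family $((V_\lambda,i_\lambda)\to(V,i))_\lambda$ is covering in $(\mathrm{fppf}/X)$. (TL 3) For each family $(U_\lambda,p_\lambda)_\lambda$ of objects of $(\mathrm{fppf}/X)$ there are a subobject $V$ of the terminal object of $(\mathrm{Zar}/X)$ and morphisms $p_\lambda(U_\lambda)\to V$ which form a covering family of $V$. (TL 4) For each object $(U,p)$ of $(\mathrm{fppf}/X)$, the representable presheaf $h_{(U,p)}$ is a sheaf. (b) The functor $u$ is cocontinuous and induces a continuous map of topoi $\epsilon:X_{\mathrm{fppf}}\to X_{\mathrm{Zar}}$, whose direct image functor is $\Gamma(V,\epsilon_*F)=\Gamma((V,i),F)$, naturally in $V$ and $F$. The induced continuous map of locales $\mathrm{Loc}(X_{\mathrm{fppf}})\to\mathrm{Loc}(X_{\mathrm{Zar}})$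 is a homeomorphism; that is, the map $\mathrm{Loc}(X_{\mathrm{Zar}})\to\mathrm{Loc}(X_{\mathrm{fppf}})$, $G\mapsto\epsilon^{-1}(G)$, is an isomorphism of ordered sets. (c) The map sending $x\in X$ to the point of $X_{\mathrm{Zar}}$ whose inverse image functor is the stalk at $x$ induces a homeomorphism $X\to|X_{\mathrm{Zar}}|_{\mathrm{sob}}$, and the map $|X_{\mathrm{fppf}}|_{\mathrm{sob}}\to|X_{\mathrm{Zar}}|_{\mathrm{sob}}=X$ induced by $\epsilon$ is a topological embedding. -/

import Mathlib

open CategoryTheory Limits TopologicalSpace AlgebraicGeometry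

universe w u v₁ v₂ v₃ u₁ u₂ u₃

noncomputable section

namespace FppfPoints

/-! ### Continuous maps of topoi, locales of topoi, spaces of points -/

/-- A continuous map `E ⟶ E'` of topoi (a geometric morphism): a pair of adjoint functors whose
left adjoint, the inverse image functor, is left exact. -/
structure ToposMap (E : Type u₁) [Category.{v₁} E] (E' : Type u₂) [Category.{v₂} E'] where
  /-- the direct image functor -/
  direct : E ⥤ E'
  /-- the inverse image functor -/
  inverse : E' ⥤ E
  /-- the adjunction between them -/
  adj : inverse ⊣ direct
  /-- the inverse image functor commutes with finite limits -/
  preservesFiniteLimits : PreservesFiniteLimits inverse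

attribute [instance] ToposMap.preservesFiniteLimits

/-- Composition of continuous maps of topoi. -/
def ToposMap.comp {E : Type u₁} [Category.{v₁} E] {E' : Type u₂} [Category.{v₂} E']
    {E'' : Type u₃} [Category.{v₃} E''] (f : ToposMap E E') (g : ToposMap E' E'') :
    ToposMap E E'' where
  direct := f.direct ⋙ g.direct
  inverse := g.inverse ⋙ f.inverse
  adj := g.adj.comp f.adj
  preservesFiniteLimits := inferInstance

/-- The underlying ordered set of the locale of a topos: the subobjects of the terminal object. -/
abbrev Loc (E : Type u₁) [Category.{v₁} E] [HasTerminal E] : Type (max u₁ v₁) :=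
  Subobject (⊤_ E)

section Loc

variable {E : Type u₁} [Category.{v₁} E] [HasTerminal E]
  {E' : Type u₂} [Category.{v₂} E'] [HasTerminal E']

lemma ToposMap.mono_from (f : ToposMap E E') (G : Loc E') :
    Mono (terminal.from (f.inverse.obj (G : E'))) := by
  have h : IsTerminal (f.inverse.obj (⊤_ E')) := terminalIsTerminal.isTerminalObj f.inverse _
  have : terminal.from (f.inverse.obj (G : E')) =
      f.inverse.map G.arrow ≫ (h.uniqueUpToIso terminalIsTerminal).hom :=
    Subsingleton.elim _ _
  rw [this]
  infer_instance

attribute [local instance] ToposMap.mono_from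

/-- The continuous map of locales `Loc E ⟶ Loc E'` induced by a continuous map `f : E ⟶ E'` of
topoi, given by the monotone map `G ↦ f⁻¹(G)` in the reverse direction. -/
def ToposMap.locMap (f : ToposMap E E') : Loc E' →o Loc E where
  toFun G := Subobject.mk (terminal.from (f.inverse.obj (G : E')))
  monotone' G H h := Subobject.mk_le_mk_of_comm
    (f.inverse.map (Subobject.ofLE G H h)) (Subsingleton.elim _ _)

end Loc

/-- Points of a topos: continuous maps from the topos of sets to it. -/
abbrev Point (E : Type u₁) [Category.{v₁} E] := ToposMap (Type u) E

/-- Two points are identified when they are isomorphic. An isomorphism of points is determined by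
its component on inverse image functors, which can be an arbitrary isomorphism. -/
instance pointSetoid (E : Type u₁) [Category.{v₁} E] : Setoid (Point.{u} E) where
  r P Q := Nonempty (P.inverse ≅ Q.inverse)
  iseqv :=
    { refl := fun _ ↦ ⟨Iso.refl _⟩
      symm := fun ⟨e⟩ ↦ ⟨e.symm⟩
      trans := fun ⟨e⟩ ⟨e'⟩ ↦ ⟨e ≪≫ e'⟩ }

/-- The set `|E|` of isomorphism classes of points of a topos. -/
def PointSpace (E : Type u₁) [Category.{v₁} E] := Quotient (pointSetoid.{u} E)

section PointSpace

variable {E : Type u₁} [Category.{v₁} E] {E' : Type u₂} [Category.{v₂} E']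

/-- The isomorphism class of a point. -/
def PointSpace.mk (P : Point.{u} E) : PointSpace.{u} E := Quotient.mk _ P

/-- The map `|E| → |E'|` induced by a continuous map of topoi. -/
def ToposMap.pointMap (f : ToposMap E E') : PointSpace.{u} E → PointSpace.{u} E' :=
  Quotient.map (fun P ↦ P.comp f) fun _ _ ⟨e⟩ ↦ ⟨Functor.isoWhiskerLeft f.inverse e⟩

variable [HasTerminal E] [HasTerminal E']

/-- The subset of `|E|` attached to a subobject `U` of the terminal object: the classes of the
points `P` with `P⁻¹(U) ≠ ∅`. -/
def PointSpace.basicOpen (U : Loc E) : Set (PointSpace.{u} E) :=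
  {p | Quotient.liftOn p (fun P ↦ Nonempty (P.inverse.obj (U : E))) fun _ _ ⟨e⟩ ↦
    propext (e.app (U : E)).toEquiv.nonempty_congr}

/-- The topology of `|E|` given by the subsets attached to the subobjects of the terminal object.
For a topos these subsets are already stable under finite intersections and arbitrary unions
(inverse image functors of points are left exact and preserve unions of subobjects), so that the
topology they generate has no further open sets. -/
instance : TopologicalSpace (PointSpace.{u} E) :=
  TopologicalSpace.generateFrom (Set.range PointSpace.basicOpen)

lemma ToposMap.preimage_basicOpen (f : ToposMap E E') (U : Loc E') :
    f.pointMap ⁻¹' PointSpace.basicOpen.{u} U = PointSpace.basicOpen.{u} (f.locMap U) := by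
  ext p
  induction p using Quotient.inductionOn with
  | h P =>
    have := f.mono_from U
    exact (P.inverse.mapIso (Subobject.underlyingIso
      (terminal.from (f.inverse.obj (U : E')))).symm).toEquiv.nonempty_congr

lemma ToposMap.continuous_pointMap (f : ToposMap E E') : Continuous f.pointMap.{u} := by
  refine continuous_generateFrom_iff.2 ?_
  rintro _ ⟨U, rfl⟩
  rw [f.preimage_basicOpen]
  exact TopologicalSpace.isOpen_generateFrom_of_mem ⟨_, rfl⟩

end PointSpace

/-! ### Sobrification -/

/-- The sobrification of a topological space, realised as its set of irreducible closed subsets. -/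
def Sobrification (Y : Type u₁) [TopologicalSpace Y] := IrreducibleCloseds Y

section Sobrification

variable {Y : Type u₁} [TopologicalSpace Y] {Z : Type u₂} [TopologicalSpace Z]

/-- The open subsets of the sobrification are the `{C | C ∩ U ≠ ∅}` with `U` open. -/
instance : TopologicalSpace (Sobrification Y) where
  IsOpen W := ∃ U : Set Y, IsOpen U ∧ W = {C : IrreducibleCloseds Y | ((C : Set Y) ∩ U).Nonempty}
  isOpen_univ := ⟨Set.univ, isOpen_univ,
    (Set.eq_univ_of_forall fun C : IrreducibleCloseds Y ↦ by
      simpa using C.isIrreducible.nonempty).symm⟩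
  isOpen_inter := by
    rintro _ _ ⟨U, hU, rfl⟩ ⟨V, hV, rfl⟩
    refine ⟨U ∩ V, hU.inter hV, Set.ext fun C ↦ ⟨fun h ↦ ?_, fun h ↦ ?_⟩⟩
    · exact IrreducibleCloseds.isIrreducible C |>.isPreirreducible U V hU hV h.1 h.2
    · exact ⟨h.mono fun x hx ↦ ⟨hx.1, hx.2.1⟩, h.mono fun x hx ↦ ⟨hx.1, hx.2.2⟩⟩
  isOpen_sUnion := by
    intro S hS
    refine ⟨⋃₀ {U | IsOpen U ∧ {C : IrreducibleCloseds Y | ((C : Set Y) ∩ U).Nonempty} ∈ S},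
      isOpen_sUnion fun U hU ↦ hU.1, Set.ext fun C ↦ ⟨?_, ?_⟩⟩
    · rintro ⟨W, hW, hC⟩
      obtain ⟨U, hU, rfl⟩ := hS W hW
      obtain ⟨x, hx, hx'⟩ := hC
      exact ⟨x, hx, U, ⟨hU, hW⟩, hx'⟩
    · rintro ⟨x, hx, U, hU, hx'⟩
      exact ⟨_, hU.2, x, hx, hx'⟩

/-- The canonical map from a space to its sobrification. -/
def toSobrification (y : Y) : Sobrification Y :=
  (⟨closure {y}, isIrreducible_singleton.closure, isClosed_closure⟩ : IrreducibleCloseds Y)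

/-- The map induced by a continuous map on sobrifications, sending `C` to the closure of `f(C)`. -/
def sobrificationMap (f : Y → Z) (hf : Continuous f) : Sobrification Y → Sobrification Z :=
  IrreducibleCloseds.map f hf

end Sobrification

/-! ### The conditions (TL 1) -- (TL 4) -/

/-- The conditions (TL 1) -- (TL 4) for functors `u : Cf ⥤ Cz`, `v : Cz ⥤ Cf` between categories
equipped with covering families `Kf`, `Kz`. -/
structure TLConditions {Cf : Type u₁} [Category.{v₁} Cf] {Cz : Type u₂} [Category.{v₂} Cz]
    [HasTerminal Cz] (Kf : Precoverage Cf) (Kz : Precoverage Cz) (u : Cf ⥤ Cz) (v : Cz ⥤ Cf) :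
    Prop where
  /-- (TL 1) `u ∘ v` is isomorphic to the identity -/
  tl1 : Nonempty (v ⋙ u ≅ 𝟭 Cz)
  /-- (TL 2) `v` sends covering families to covering families -/
  tl2 : ∀ {V : Cz} {ι : Type w} (W : ι → Cz) (f : ∀ i, W i ⟶ V),
    Presieve.ofArrows W f ∈ Kz V →
      Presieve.ofArrows (fun i ↦ v.obj (W i)) (fun i ↦ v.map (f i)) ∈ Kf (v.obj V)
  /-- (TL 3) for each family of objects of `Cf`, the images under `u` cover a subobject of the
  terminal object -/
  tl3 : ∀ {ι : Type w} (U : ι → Cf), ∃ (V : Cz) (_ : Mono (terminal.from V))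
    (f : ∀ i, u.obj (U i) ⟶ V), Presieve.ofArrows (fun i ↦ u.obj (U i)) f ∈ Kz V
  /-- (TL 4) representable presheaves on `Cf` are sheaves -/
  tl4 : ∀ U : Cf, Presieve.IsSheaf Kf.toGrothendieck (yoneda.obj U)

/-! ### The Zariski and the small fppf site -/

/-- The property of being flat and locally of finite presentation. -/
abbrev flatLfp : MorphismProperty Scheme.{u} := @Flat ⊓ @LocallyOfFinitePresentation

variable (X : Scheme.{u})

/-- The category `(fppf/X)`: objects are the `X`-schemes `(U, p)` with `p` flat and locally of
finite presentation, morphisms are arbitrary `X`-morphisms. -/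
abbrev FppfSite := flatLfp.{u}.Over ⊤ X

/-- The fppf coverings in `(fppf/X)`: families of flat morphisms that are jointly surjective. -/
def fppfCoverings : Precoverage (FppfSite X) where
  coverings U := {R | (∀ ⦃W : FppfSite X⦄ (f : W ⟶ U), R f → Flat f.left) ∧
    ∀ y : U.left, ∃ (W : FppfSite X) (f : W ⟶ U), R f ∧ y ∈ Set.range f.left}

/-- The Grothendieck topology on `(fppf/X)` generated by the fppf coverings. -/
def fppfTopology : GrothendieckTopology (FppfSite X) := (fppfCoverings X).toGrothendieck

/-- The topos `X_fppf` of sheaves on `(fppf/X)`. -/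
abbrev FppfTopos := Sheaf (fppfTopology X) (Type u)

/-- The coverings of the site `(Zar/X)` of open subschemes of `X`, which are the families of
inclusions with union the given open. They generate `Opens.grothendieckTopology X`. -/
def zarCoverings : Precoverage X.Opens := (Opens.pretopology X).toPrecoverage

/-- The topos `X_Zar` of sheaves on `X`. -/
abbrev ZarTopos := Sheaf (Opens.grothendieckTopology X) (Type u)

/-- The functor `u : (fppf/X) ⥤ (Zar/X)`, `(U, p) ↦ p(U)`. -/
def imageFunctor : FppfSite X ⥤ X.Opens where
  obj U := ⟨Set.range U.hom, by
    have : Flat U.hom := U.prop.1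
    have : LocallyOfFinitePresentation U.hom := U.prop.2
    exact U.hom.isOpenMap.isOpen_range⟩
  map {U W} f := homOfLE (by
    rintro _ ⟨y, rfl⟩
    refine ⟨f.left y, ?_⟩
    have h : f.left ≫ W.hom = U.hom := MorphismProperty.Over.w f
    rw [← Scheme.Hom.comp_apply, h])

/-- The functor `v : (Zar/X) ⥤ (fppf/X)`, `V ↦ (V, i)` with `i` the inclusion. -/
def inclusionFunctor : X.Opens ⥤ FppfSite X :=
  MorphismProperty.Comma.lift X.restrictFunctor
    (fun V ↦ ⟨inferInstanceAs (Flat V.ι), inferInstanceAs (LocallyOfFinitePresentation V.ι)⟩)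
    (fun _ ↦ trivial) (fun _ ↦ trivial)

variable {X}

/-- The point of the topos `X_Zar` given by a point `x` of `X`: its inverse image functor is the
stalk at `x`, its direct image functor forms skyscraper sheaves. -/
def stalkPoint (x : X) : Point.{u} (ZarTopos X) where
  direct := (Opens.pointGrothendieckTopology x).skyscraperSheafFunctor
  inverse := (Opens.pointGrothendieckTopology x).sheafFiber
  adj := (Opens.pointGrothendieckTopology x).skyscraperSheafAdjunction
  preservesFiniteLimits := inferInstance

end FppfPoints

end

noncomputable section

namespace FppfPoints

/-! ### Geometry of the fppf site -/

/-! Everything rests on one geometric fact: for `(U, p)` in the site, `p` is open and `U ⟶ p(U)` is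
itself an fppf covering. Covers of `p(U)` pull back to covers of `U`, which makes `u` cocontinuous;
TL 4 is fppf descent for morphisms of schemes.

Since the fppf site is not small, `ε⁻¹G` is built without general sheafification. The presheaf `U ↦
G(p(U))` embeds, by taking germs, into the sheaf of all functions from `U` to the étalé space of `G`
(`germMap`), and `ε⁻¹G` consists of the functions that lie locally in its image. Its universal
property together with `u ⊣ v` gives `ε⁻¹ ⊣ ε_*`. Left exactness holds because sections of `ε⁻¹G`
lift locally and uniquely to `G(p(U))`, and finitely many sections lift over a common covering sieve
(`existsUnique_inverseSections`).

A subterminal sheaf is determined by the objects over which it has a section. On the fppf side this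
depends only on `p(U)`, by descent along `U ⟶ p(U)` (`nonempty_sections_image`), so both locales are
the lattice of opens of `X`.

For a point `P` of the Zariski topos, `P⁻¹F = ∅` exactly when `F` maps to `P_*∅`. The complement of
the open set of `P_*∅` is irreducible, and its generic point locates `P` (`exists_location`). The
location map induces the topology and has the stalk points as a section, which identifies the
sobrification with `X`. Surjectivity on locales makes the map on point spaces inducing, and
sobrification turns an inducing map into an embedding. -/

/-- Cancellation for properties of morphisms of schemes that come from properties of ring
homomorphisms. -/
lemma hasRingHomProperty_of_comp {P P' : MorphismProperty Scheme.{u}}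
    {Q Q' : ∀ {R S : Type u} [CommRing R] [CommRing S], (R →+* S) → Prop}
    [HasRingHomProperty P Q] [HasRingHomProperty P' Q']
    (H : ∀ {R S T : Type u} [CommRing R] [CommRing S] [CommRing T],
      ∀ (f : R →+* S) (g : S →+* T), Q (g.comp f) → Q' f → Q g)
    {X Y Z : Scheme.{u}} {f : X ⟶ Y} {g : Y ⟶ Z} (h : P (f ≫ g)) (hg : P' g) : P f := by
  wlog hZ : IsAffine Z generalizing X Y Z
  · rw [IsZariskiLocalAtTarget.iff_of_iSup_eq_top (P := P) _
      (g.iSup_preimage_eq_top (iSup_affineOpens_eq_top Z))]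
    intro U
    have H := IsZariskiLocalAtTarget.restrict h U.1
    rw [morphismRestrict_comp] at H
    exact this H (IsZariskiLocalAtTarget.restrict hg U.1) inferInstance
  wlog hY : IsAffine Y generalizing X Y
  · rw [IsZariskiLocalAtTarget.iff_of_iSup_eq_top (P := P) _ (iSup_affineOpens_eq_top Y)]
    intro U
    have H := HasRingHomProperty.comp_of_isOpenImmersion P (f ⁻¹ᵁ U.1).ι (f ≫ g) h
    rw [← morphismRestrict_ι_assoc] at H
    exact this H (HasRingHomProperty.comp_of_isOpenImmersion P' U.1.ι g hg) inferInstance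
  wlog hX : IsAffine X generalizing X
  · rw [IsZariskiLocalAtSource.iff_of_iSup_eq_top (P := P) _ (iSup_affineOpens_eq_top X)]
    intro U
    have H := HasRingHomProperty.comp_of_isOpenImmersion P U.1.ι (f ≫ g) h
    rw [← Category.assoc] at H
    exact this H inferInstance
  rw [HasRingHomProperty.iff_of_isAffine (P := P)] at h ⊢
  rw [HasRingHomProperty.iff_of_isAffine (P := P')] at hg
  rw [Scheme.Hom.comp_appTop, CommRingCat.hom_comp] at h
  exact H _ _ h hg

/-- If `f ≫ g` is locally of finite presentation and `g` is locally of finite type, then `f` is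
locally of finite presentation. -/
lemma locallyOfFinitePresentation_of_comp {X Y Z : Scheme.{u}} (f : X ⟶ Y) (g : Y ⟶ Z)
    (h : LocallyOfFinitePresentation (f ≫ g)) (hg : LocallyOfFiniteType g) :
    LocallyOfFinitePresentation f :=
  hasRingHomProperty_of_comp (P := @LocallyOfFinitePresentation) (P' := @LocallyOfFiniteType)
    (fun f _ h hf ↦ RingHom.FinitePresentation.of_comp_finiteType f h hf) h hg

variable {X : Scheme.{u}}

instance flat_hom (U : FppfSite X) : Flat U.hom := U.prop.1

instance locallyOfFinitePresentation_hom (U : FppfSite X) :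
    LocallyOfFinitePresentation U.hom := U.prop.2

lemma left_comp_hom {U W : FppfSite X} (f : W ⟶ U) : f.left ≫ U.hom = W.hom :=
  MorphismProperty.Over.w f

lemma hom_left_apply {U W : FppfSite X} (f : W ⟶ U) (y : W.left) :
    U.hom (f.left y) = W.hom y := by
  rw [← Scheme.Hom.comp_apply, left_comp_hom]

/-- Finite presentation is automatic for arrows of the site, which is why coverings only ask for
flatness. -/
instance locallyOfFinitePresentation_left {U W : FppfSite X} (f : W ⟶ U) :
    LocallyOfFinitePresentation f.left :=
  locallyOfFinitePresentation_of_comp f.left U.hom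
    (by rw [left_comp_hom]; infer_instance) inferInstance

/-- An `X`-scheme that is flat and locally of finite presentation over an object of the site. -/
abbrev overMk (U : FppfSite X) {T : Scheme.{u}} (f : T ⟶ U.left) [Flat f]
    [LocallyOfFinitePresentation f] : FppfSite X :=
  MorphismProperty.Over.mk ⊤ (f ≫ U.hom)
    ⟨inferInstanceAs (Flat (f ≫ U.hom)), inferInstanceAs (LocallyOfFinitePresentation (f ≫ U.hom))⟩

/-- The structure morphism of `overMk U f`. -/
abbrev overMkHom (U : FppfSite X) {T : Scheme.{u}} (f : T ⟶ U.left) [Flat f]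
    [LocallyOfFinitePresentation f] : overMk U f ⟶ U :=
  MorphismProperty.Over.homMk f rfl trivial

section FiberProduct

variable {U V W : FppfSite X} (f : W ⟶ U) (g : V ⟶ U) [Flat f.left]

/-- The fiber product of `f : W ⟶ U` and `g : V ⟶ U` with `f` flat. -/
abbrev fiberProduct : FppfSite X := overMk V (pullback.snd f.left g.left)

/-- The first projection of the fiber product. -/
abbrev fiberProductFst : fiberProduct f g ⟶ W :=
  MorphismProperty.Over.homMk (pullback.fst f.left g.left) (by
    have h := pullback.condition_assoc (f := f.left) (g := g.left) U.hom
    rw [left_comp_hom f, left_comp_hom g] at h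
    exact h) trivial

/-- The second projection of the fiber product. -/
abbrev fiberProductSnd : fiberProduct f g ⟶ V := overMkHom V (pullback.snd f.left g.left)

lemma fiberProduct_condition :
    fiberProductFst f g ≫ f = fiberProductSnd f g ≫ g :=
  MorphismProperty.Over.Hom.ext pullback.condition

lemma exists_fiberProduct (w : W.left) (v : V.left) (h : f.left w = g.left v) :
    ∃ t : (fiberProduct f g).left, (fiberProductFst f g).left t = w ∧
      (fiberProductSnd f g).left t = v :=
  Scheme.Pullback.exists_preimage_pullback w v h

/-- Compatibility in the site is tested only on objects of the site, whereas descent for schemes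
tests all `T`. The fiber product is universal among all schemes and lies in the site, so the first
implies the second. -/
lemma comp_left_eq_of_fiberProduct {Z : FppfSite X} (p : W ⟶ Z) (q : V ⟶ Z)
    (h : fiberProductFst f g ≫ p = fiberProductSnd f g ≫ q) {T : Scheme.{u}} (a : T ⟶ W.left)
    (b : T ⟶ V.left) (hab : a ≫ f.left = b ≫ g.left) : a ≫ p.left = b ≫ q.left := by
  have h' : pullback.fst f.left g.left ≫ p.left = pullback.snd f.left g.left ≫ q.left :=
    congr_arg (fun a ↦ a.left) h
  have := congr_arg (fun c ↦ pullback.lift a b hab ≫ c) h'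
  simpa only [pullback.lift_fst_assoc, pullback.lift_snd_assoc] using this

end FiberProduct

/-- The pointwise criterion holds for the generating coverings and survives pullback and
transitivity, because flat arrows are stable under base change and composition. Conversely, the flat
arrows of `S` already form a covering family. -/
lemma mem_fppfTopology_iff {U : FppfSite X} {S : Sieve U} :
    S ∈ fppfTopology X U ↔
      ∀ y : U.left, ∃ (W : FppfSite X) (f : W ⟶ U), S f ∧ Flat f.left ∧ y ∈ Set.range f.left := by
  constructor
  · intro hS
    induction hS with
    | of U R hR =>
      intro y
      obtain ⟨W, f, hf, hy⟩ := hR.2 y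
      exact ⟨W, f, Sieve.le_generate R _ _ hf, hR.1 f hf, hy⟩
    | top U => exact fun y ↦ ⟨U, 𝟙 U, trivial, inferInstanceAs (Flat (𝟙 U.left)), y, rfl⟩
    | pullback U S _ V g ih =>
      intro y
      obtain ⟨W, f, hf, hflat, w, hw⟩ := ih (g.left y)
      obtain ⟨t, -, ht⟩ := exists_fiberProduct f g w y hw
      refine ⟨_, fiberProductSnd f g, ?_, inferInstanceAs (Flat (pullback.snd f.left g.left)), t, ht⟩
      rw [Sieve.pullback_apply, ← fiberProduct_condition]
      exact S.downward_closed hf _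
    | transitive U S R _ _ ih₁ ih₂ =>
      intro y
      obtain ⟨W, f, hf, hflat, w, rfl⟩ := ih₁ y
      obtain ⟨T, g, hg, hgflat, t, rfl⟩ := ih₂ hf w
      exact ⟨T, g ≫ f, hg, inferInstanceAs (Flat (g.left ≫ f.left)), t, rfl⟩
  · intro h
    let R : Presieve U := fun W f ↦ S f ∧ Flat f.left
    refine (fppfTopology X).superset_covering (S := Sieve.generate R) ?_
      (Precoverage.generate_mem_toGrothendieck ⟨fun W f hf ↦ hf.2, fun y ↦ ?_⟩)
    · rw [Sieve.generate_le_iff]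
      exact fun W f hf ↦ hf.1
    · obtain ⟨W, f, hf, hflat, hy⟩ := h y
      exact ⟨W, f, ⟨hf, hflat⟩, hy⟩

/-! ### Fppf descent for morphisms of schemes -/

section Family

variable {U : FppfSite X} {ι : Type*} {W : ι → FppfSite X} (f : ∀ i, W i ⟶ U)

/-- The fppf topology on all schemes is subcanonical, and the given family is one of its coverings.
-/
lemma existsUnique_hom_of_cover
    (hf : ∀ i, Flat (f i).left) (hs : ∀ y : U.left, ∃ i, y ∈ Set.range (f i).left)
    {T : Scheme.{u}} (x : ∀ i, (W i).left ⟶ T)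
    (hx : ∀ i j (S : Scheme.{u}) (a : S ⟶ (W i).left) (b : S ⟶ (W j).left),
      a ≫ (f i).left = b ≫ (f j).left → a ≫ x i = b ≫ x j) :
    ∃! t : U.left ⟶ T, ∀ i, (f i).left ≫ t = x i := by
  have hcov : Presieve.ofArrows (fun i ↦ (W i).left) (fun i ↦ (f i).left) ∈
      Scheme.fppfPrecoverage U.left := by
    rw [Scheme.fppfPrecoverage, Scheme.ofArrows_mem_precoverage_iff]
    exact ⟨hs, fun i ↦ ⟨hf i, inferInstance⟩⟩
  have hfor := (GrothendieckTopology.Subcanonical.isSheaf_of_isRepresentable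
    (J := Scheme.fppfTopology) (yoneda.obj T)).isSheafFor _
      (Precoverage.generate_mem_toGrothendieck hcov)
  rw [Presieve.isSheafFor_arrows_iff] at hfor
  exact hfor x fun i j S a b hab ↦ hx i j S a b hab

lemma hom_ext_of_cover
    (hf : ∀ i, Flat (f i).left) (hs : ∀ y : U.left, ∃ i, y ∈ Set.range (f i).left)
    {T : Scheme.{u}} (a b : U.left ⟶ T)
    (h : ∀ i, (f i).left ≫ a = (f i).left ≫ b) : a = b :=
  (existsUnique_hom_of_cover f hf hs (fun i ↦ (f i).left ≫ b) fun i j S c d hcd ↦ by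
    rw [← Category.assoc, hcd, Category.assoc]).unique h fun _ ↦ rfl

end Family

/-- Representable presheaves on `(fppf/X)` are sheaves. -/
lemma isSheaf_yoneda_obj (Z : FppfSite X) :
    Presieve.IsSheaf (fppfTopology X) (yoneda.obj Z) := by
  intro U S hS x hx
  rw [mem_fppfTopology_iff] at hS
  choose W f hf hflat hy using hS
  obtain ⟨t, ht, -⟩ := existsUnique_hom_of_cover f hflat (fun y ↦ ⟨y, hy y⟩)
    (fun y ↦ (x (f y) (hf y)).left) fun i j T a b hab ↦
      comp_left_eq_of_fiberProduct (f i) (f j) _ _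
        (hx _ _ (hf i) (hf j) (fiberProduct_condition _ _)) a b hab
  have hw : t ≫ Z.hom = U.hom := hom_ext_of_cover f hflat (fun y ↦ ⟨y, hy y⟩) _ _ fun y ↦ by
    rw [← Category.assoc, ht, left_comp_hom, left_comp_hom]
  refine ⟨MorphismProperty.Over.homMk t hw trivial, fun V g hg ↦ ?_, fun b hb ↦ ?_⟩
  -- An arbitrary arrow `g` of `S` need not be flat nor belong to the chosen family, so the equality
  -- is tested on the pullback of that family along `g`.
  · refine MorphismProperty.Over.Hom.ext (hom_ext_of_cover
      (fun v : V.left ↦ fiberProductSnd (f (g.left v)) g)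
      (fun v ↦ inferInstanceAs (Flat (pullback.snd (f (g.left v)).left g.left))) (fun v ↦ ?_)
      _ _ fun v ↦ ?_)
    · obtain ⟨w, hw⟩ := hy (g.left v)
      obtain ⟨s, -, hs⟩ := exists_fiberProduct (f (g.left v)) g w v hw
      exact ⟨v, s, hs⟩
    · have h₁ : (fiberProductFst (f (g.left v)) g).left ≫ (x _ (hf (g.left v))).left =
          (fiberProductSnd (f (g.left v)) g).left ≫ (x g hg).left :=
        congr_arg (fun a : fiberProduct (f (g.left v)) g ⟶ Z ↦ a.left)
          (hx _ _ (hf _) hg (fiberProduct_condition _ _))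
      have h₂ : (fiberProductFst (f (g.left v)) g).left ≫ (f (g.left v)).left =
          (fiberProductSnd (f (g.left v)) g).left ≫ g.left :=
        congr_arg (fun a ↦ a.left) (fiberProduct_condition (f (g.left v)) g)
      refine Eq.trans ?_ h₁
      rw [← ht]
      exact ((Category.assoc _ _ _).symm.trans (congr_arg (· ≫ t) h₂.symm)).trans
        (Category.assoc _ _ _)
  · exact MorphismProperty.Over.Hom.ext (hom_ext_of_cover f hflat (fun y ↦ ⟨y, hy y⟩) _ _ fun y ↦
      (congr_arg (fun a ↦ a.left) (hb (f y) (hf y))).trans (ht y).symm)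

/-! ### The functors `u` and `v` -/

lemma hom_mem_imageFunctor_obj (U : FppfSite X) (y : U.left) :
    U.hom y ∈ (imageFunctor X).obj U := ⟨y, rfl⟩

lemma imageFunctor_obj_inclusionFunctor_obj (V : X.Opens) :
    (imageFunctor X).obj ((inclusionFunctor X).obj V) = V :=
  TopologicalSpace.Opens.ext V.range_ι

instance (U : FppfSite X) (V : X.Opens) : Subsingleton (U ⟶ (inclusionFunctor X).obj V) where
  allEq f g := by
    refine MorphismProperty.Over.Hom.ext ((cancel_mono V.ι).1 ?_)
    exact (left_comp_hom f).trans (left_comp_hom g).symm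

/-- The morphism of schemes underlying `toInclusion`. -/
def toInclusionLeft {U : FppfSite X} {V : X.Opens} (h : (imageFunctor X).obj U ≤ V) :
    U.left ⟶ (V : Scheme.{u}) :=
  IsOpenImmersion.lift V.ι (U.hom : U.left ⟶ X) (by rw [V.range_ι]; exact h)

/-- The morphism `(U, p) ⟶ (V, i)` given by an inclusion `p(U) ⊆ V`. -/
def toInclusion {U : FppfSite X} {V : X.Opens} (h : (imageFunctor X).obj U ≤ V) :
    U ⟶ (inclusionFunctor X).obj V :=
  MorphismProperty.Over.homMk (toInclusionLeft h)
    (IsOpenImmersion.lift_fac V.ι (U.hom : U.left ⟶ X) _) trivial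

variable (X) in
/-- The functor `(U, p) ↦ p(U)` is left adjoint to `V ↦ (V, i)`. -/
def imageInclusionAdjunction : imageFunctor X ⊣ inclusionFunctor X :=
  Adjunction.mkOfHomEquiv
    { homEquiv _ V :=
        { toFun f := toInclusion f.le
          invFun f := homOfLE (((imageFunctor X).map f).le.trans
            (imageFunctor_obj_inclusionFunctor_obj V).le)
          left_inv _ := Subsingleton.elim _ _
          right_inv _ := Subsingleton.elim _ _ }
      homEquiv_naturality_left_symm _ _ := Subsingleton.elim _ _
      homEquiv_naturality_right _ _ := Subsingleton.elim _ _ }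

/-- The open subscheme `p⁻¹(V)` of `(U, p)`. -/
abbrev preimage (U : FppfSite X) (V : X.Opens) : FppfSite X := overMk U (U.hom ⁻¹ᵁ V).ι

lemma imageFunctor_obj_preimage_le (U : FppfSite X) (V : X.Opens) :
    (imageFunctor X).obj (preimage U V) ≤ V := by
  rintro _ ⟨y, rfl⟩
  exact y.2

/-- If opens `V` cover `p(U)`, then the open subschemes `p⁻¹(V)` cover `U`, and their images lie in
`V`. -/
instance : (imageFunctor X).IsCocontinuous (fppfTopology X) (Opens.grothendieckTopology X) where
  cover_lift {U S} hS := by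
    rw [mem_fppfTopology_iff]
    intro y
    obtain ⟨V, f, hf, hy⟩ := hS (U.hom y) (hom_mem_imageFunctor_obj U y)
    refine ⟨preimage U V, overMkHom U (U.hom ⁻¹ᵁ V).ι, ?_,
      inferInstanceAs (Flat (U.hom ⁻¹ᵁ V).ι), ⟨y, hy⟩, rfl⟩
    have := S.downward_closed hf (homOfLE (imageFunctor_obj_preimage_le U V))
    rwa [Subsingleton.elim (_ ≫ f) ((imageFunctor X).map (overMkHom U (U.hom ⁻¹ᵁ V).ι))] at this

instance : (inclusionFunctor X).IsContinuous (Opens.grothendieckTopology X) (fppfTopology X) :=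
  (imageInclusionAdjunction X).isContinuous_of_isCocontinuous _ _

lemma ofArrows_mem_zarCoverings_iff {ι : Type*} {V : X.Opens} {W : ι → X.Opens}
    {f : ∀ i, W i ⟶ V} :
    Presieve.ofArrows W f ∈ zarCoverings X V ↔ ∀ x ∈ V, ∃ i, x ∈ W i := by
  refine forall₂_congr fun x _ ↦ ⟨?_, ?_⟩
  · rintro ⟨_, _, ⟨i⟩, hi⟩
    exact ⟨i, hi⟩
  · rintro ⟨i, hi⟩
    exact ⟨_, _, ⟨i⟩, hi⟩

variable (X) in
lemma tlConditions : TLConditions.{w} (fppfCoverings X) (zarCoverings X)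
    (imageFunctor X) (inclusionFunctor X) where
  tl1 := ⟨NatIso.ofComponents (fun V ↦ eqToIso (imageFunctor_obj_inclusionFunctor_obj V))⟩
  tl2 {V ι} W f h := by
    rw [ofArrows_mem_zarCoverings_iff] at h
    refine ⟨?_, fun y ↦ ?_⟩
    · rintro _ _ ⟨i⟩
      exact inferInstanceAs (Flat (X.homOfLE (f i).le))
    · obtain ⟨i, hi⟩ := h (V.ι y) y.2
      exact ⟨_, _, ⟨i⟩, ⟨⟨V.ι y, hi⟩, by
        apply V.ι.isOpenEmbedding.injective
        exact hom_left_apply ((inclusionFunctor X).map (f i)) _⟩⟩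
  tl3 U := by
    refine ⟨⨆ i, (imageFunctor X).obj (U i), ⟨fun _ _ _ ↦ Subsingleton.elim _ _⟩,
      fun i ↦ homOfLE (le_iSup (fun i ↦ (imageFunctor X).obj (U i)) i), ?_⟩
    rw [ofArrows_mem_zarCoverings_iff]
    intro x hx
    exact TopologicalSpace.Opens.mem_iSup.1 hx
  tl4 U := isSheaf_yoneda_obj U

/-! ### Sobrification -/

section Sobrification

variable {Y : Type u₁} [TopologicalSpace Y] {Z : Type u₂} [TopologicalSpace Z]

/-- The subset of the sobrification attached to a subset of the space. -/
def meeting (U : Set Y) : Set (Sobrification Y) :=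
  {C : IrreducibleCloseds Y | ((C : Set Y) ∩ U).Nonempty}

/-- The closure of `{y}` meets an open set exactly when `y` lies in it. -/
lemma isInducing_toSobrification : Topology.IsInducing (toSobrification (Y := Y)) := by
  refine ⟨TopologicalSpace.ext_iff.2 fun U ↦ ?_⟩
  have key (V : Set Y) (hV : IsOpen V) : toSobrification ⁻¹' meeting V = V := by
    ext y
    change (closure {y} ∩ V).Nonempty ↔ y ∈ V
    rw [closure_inter_open_nonempty_iff hV, Set.singleton_inter_nonempty]
  rw [isOpen_induced_iff]
  constructor
  · exact fun hU ↦ ⟨_, ⟨U, hU, rfl⟩, key U hU⟩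
  · rintro ⟨_, ⟨V, hV, rfl⟩, rfl⟩
    exact (congr_arg IsOpen (key V hV)).mpr hV

/-- Injectivity of `f` is not needed: for inducing `f`, a closed `C` is recovered as the preimage of
the closure of `f(C)`. -/
lemma isEmbedding_sobrificationMap {f : Y → Z} (hf : Topology.IsInducing f) :
    Topology.IsEmbedding (sobrificationMap f hf.continuous) := by
  have key (V : Set Z) (hV : IsOpen V) :
      sobrificationMap f hf.continuous ⁻¹' meeting V = meeting (f ⁻¹' V) := by
    ext (C : IrreducibleCloseds Y)
    change (closure (f '' (C : Set Y)) ∩ V).Nonempty ↔ ((C : Set Y) ∩ f ⁻¹' V).Nonempty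
    rw [closure_inter_open_nonempty_iff hV, Set.image_inter_nonempty_iff]
  refine ⟨⟨TopologicalSpace.ext_iff.2 fun U ↦ ?_⟩, fun (C D : IrreducibleCloseds Y) h ↦ ?_⟩
  · rw [isOpen_induced_iff]
    constructor
    · rintro ⟨U, hU, rfl⟩
      obtain ⟨V, hV, rfl⟩ := hf.isOpen_iff.1 hU
      exact ⟨_, ⟨V, hV, rfl⟩, key V hV⟩
    · rintro ⟨_, ⟨V, hV : IsOpen V, rfl⟩, rfl⟩
      exact ⟨_, hV.preimage hf.continuous, key V hV⟩
  · refine IrreducibleCloseds.ext ?_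
    have h' : closure (f '' (C : Set Y)) = closure (f '' (D : Set Y)) :=
      congr_arg (fun E : IrreducibleCloseds Z ↦ (E : Set Z)) h
    rw [← C.isClosed.closure_eq, ← D.isClosed.closure_eq,
      hf.closure_eq_preimage_closure_image, h', ← hf.closure_eq_preimage_closure_image]

/-- If `g : Y → Z` induces the topology of `Y` and has a section `s`, and `Z` is sober, then `s`
identifies `Z` with the sobrification of `Y`. -/
lemma exists_homeomorph_sobrification [QuasiSober Z] [T0Space Z] {g : Y → Z}
    (hg : Topology.IsInducing g) {s : Z → Y} (hs : ∀ z, g (s z) = z) :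
    ∃ h : Z ≃ₜ Sobrification Y, ∀ z, h z = toSobrification (s z) := by
  have hind : Topology.IsInducing s := hg.of_comp_iff.1 (by
    rw [show g ∘ s = id from funext hs]
    exact .id)
  have hind' := isInducing_toSobrification.comp hind
  refine ⟨(Equiv.ofBijective _ ⟨hind'.injective, fun C ↦ ?_⟩).toHomeomorphOfIsInducing hind',
    fun _ ↦ rfl⟩
  -- Surjectivity: with `z` the generic point of the closure of `g(C)`, both `C` and the closure of
  -- `{s z}` are the preimage under `g` of the closure of `{z}`.
  obtain ⟨z, hz⟩ := QuasiSober.sober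
    ((IrreducibleCloseds.isIrreducible C).image g hg.continuous.continuousOn).closure
    isClosed_closure
  refine ⟨z, IrreducibleCloseds.ext ?_⟩
  change closure {s z} = C.carrier
  rw [hg.closure_eq_preimage_closure_image, Set.image_singleton, hs, hz.def,
    ← hg.closure_eq_preimage_closure_image]
  exact (IrreducibleCloseds.isClosed C).closure_eq

end Sobrification

/-! ### Subterminal objects -/

lemma ToposMap.isSubterminal_direct {E : Type u₁} [Category.{v₁} E] {E' : Type u₂}
    [Category.{v₂} E'] (f : ToposMap E E') {A : E} (hA : IsSubterminal A) :
    IsSubterminal (f.direct.obj A) :=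
  fun _ _ _ ↦ (f.adj.homEquiv _ _).symm.injective (hA _ _)

section Subterminal

variable {E : Type u₁} [Category.{v₁} E] [HasTerminal E]
  {E' : Type u₂} [Category.{v₂} E'] [HasTerminal E']

lemma isSubterminal_loc (G : Loc E) : IsSubterminal (G : E) :=
  fun _ _ _ ↦ (cancel_mono G.arrow).1 (Subsingleton.elim _ _)

lemma loc_le_iff {G H : Loc E} : G ≤ H ↔ Nonempty ((G : E) ⟶ (H : E)) :=
  ⟨fun h ↦ ⟨Subobject.ofLE G H h⟩, fun ⟨f⟩ ↦ Subobject.le_of_comm f (Subsingleton.elim _ _)⟩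

/-- The subobject of the terminal object given by a subterminal object. -/
def locMk {A : E} (hA : IsSubterminal A) : Loc E :=
  haveI := hA.mono_terminal_from
  Subobject.mk (terminal.from A)

/-- The object underlying `locMk hA`. -/
def locMkIso {A : E} (hA : IsSubterminal A) : (locMk hA : E) ≅ A :=
  haveI := hA.mono_terminal_from
  Subobject.underlyingIso (terminal.from A)

/-- The object underlying `f.locMap G`. -/
def ToposMap.locMapIso (f : ToposMap E E') (G : Loc E') :
    (f.locMap G : E) ≅ f.inverse.obj (G : E') :=
  haveI := f.mono_from G
  Subobject.underlyingIso (terminal.from (f.inverse.obj (G : E')))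

end Subterminal

/-! ### Subterminal sheaves and the objects over which they have sections -/

section Sheaf

variable {C : Type u₁} [Category.{v₁} C] {J : GrothendieckTopology C}

lemma subsingleton_sections_iff {F : Sheaf J (Type w)} :
    IsSubterminal F ↔ ∀ U, Subsingleton (F.obj.obj U) := by
  constructor
  · intro h U
    have := h.mono_terminal_from
    have h₁ : Function.Injective (((sheafToPresheaf J (Type w) ⋙
        (evaluation _ _).obj U)).map (terminal.from F)) := by
      rw [← mono_iff_injective]
      infer_instance
    have h₂ : IsTerminal ((sheafToPresheaf J (Type w) ⋙ (evaluation _ _).obj U).obj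
      (⊤_ (Sheaf J (Type w)))) := terminalIsTerminal.isTerminalObj _ _
    have := (Types.isTerminalEquivUnique _ h₂).instSubsingleton
    exact h₁.subsingleton
  · intro h Z f g
    ext U x
    exact (h U).elim _ _

lemma nonempty_hom_iff {F G : Sheaf J (Type w)} (hG : IsSubterminal G) :
    Nonempty (F ⟶ G) ↔ ∀ U, Nonempty (F.obj.obj U) → Nonempty (G.obj.obj U) := by
  rw [subsingleton_sections_iff] at hG
  refine ⟨fun ⟨f⟩ U ⟨x⟩ ↦ ⟨f.hom.app U x⟩, fun h ↦ ⟨⟨?_⟩⟩⟩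
  exact
    { app U := ↾fun x ↦ (h U ⟨x⟩).some
      naturality _ V _ := by
        ext x
        exact (hG V).elim _ _ }

/-- Sections of a subterminal sheaf are unique, so any local choices are compatible and glue. -/
lemma nonempty_sections_of_mem {F : Sheaf J (Type w)} (hF : IsSubterminal F) {U : C}
    {S : Sieve U} (hS : S ∈ J U)
    (h : ∀ ⦃W : C⦄ (f : W ⟶ U), S f → Nonempty (F.obj.obj (Opposite.op W))) :
    Nonempty (F.obj.obj (Opposite.op U)) := by
  rw [subsingleton_sections_iff] at hF
  obtain ⟨t, -⟩ := ((isSheaf_iff_isSheaf_of_type _ _).1 F.property) S hS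
    (fun W f hf ↦ (h f hf).some) fun _ _ _ _ _ _ _ _ _ _ ↦ (hF _).elim _ _
  exact ⟨t⟩

end Sheaf

/-! ### Points of the Zariski topos -/

/-- The largest open over which a subterminal sheaf has a section. -/
def support (F : ZarTopos X) : X.Opens :=
  sSup {V | Nonempty (F.obj.obj (Opposite.op V))}

lemma nonempty_sections_iff {F : ZarTopos X} (hF : IsSubterminal F) {V : X.Opens} :
    Nonempty (F.obj.obj (Opposite.op V)) ↔ V ≤ support F := by
  refine ⟨fun h ↦ le_sSup h, fun h ↦ ?_⟩
  let S : Sieve V :=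
    { arrows W _ := Nonempty (F.obj.obj (Opposite.op W))
      downward_closed {_ _ _} hW g := hW.map (F.obj.map g.op) }
  refine nonempty_sections_of_mem hF (S := S) (fun x hx ↦ ?_) fun _ _ hf ↦ hf
  obtain ⟨W, hW, hxW⟩ := TopologicalSpace.Opens.mem_sSup.1 (h hx)
  exact ⟨W ⊓ V, homOfLE inf_le_right, Nonempty.map (F.obj.map (homOfLE inf_le_left).op) hW, hxW, hx⟩

lemma nonempty_hom_iff_support_le {F G : ZarTopos X} (hG : IsSubterminal G) :
    Nonempty (F ⟶ G) ↔ support F ≤ support G := by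
  rw [nonempty_hom_iff hG]
  constructor
  · exact fun h ↦ sSup_le fun V hV ↦ (nonempty_sections_iff hG).1 (h _ hV)
  · exact fun h V hV ↦ (nonempty_sections_iff hG).2 (le_trans (le_sSup hV) h)

/-- The subsheaf of the terminal sheaf given by an open subset. -/
def openSheaf (V : X.Opens) : ZarTopos X where
  obj :=
    { obj W := ULift.{u} (PLift (W.unop ≤ V))
      map f := ↾fun h ↦ ⟨⟨f.unop.le.trans h.down.down⟩⟩ }
  property := by
    rw [isSheaf_iff_isSheaf_of_type]
    intro U S hS x hx
    refine ⟨⟨⟨fun y hy ↦ ?_⟩⟩, fun _ _ _ ↦ Subsingleton.elim _ _, fun _ _ ↦ Subsingleton.elim _ _⟩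
    obtain ⟨W, f, hf, hyW⟩ := hS y hy
    exact (x f hf).down.down hyW

lemma isSubterminal_openSheaf (V : X.Opens) : IsSubterminal (openSheaf V) :=
  subsingleton_sections_iff.2 fun W ↦ inferInstanceAs (Subsingleton (ULift (PLift (W.unop ≤ V))))

lemma support_openSheaf (V : X.Opens) : support (openSheaf V) = V :=
  le_antisymm (sSup_le fun _ ⟨h⟩ ↦ h.down.down) (le_sSup ⟨⟨⟨le_rfl⟩⟩⟩)

lemma support_congr {F G : ZarTopos X} (e : F ≅ G) : support F = support G := by
  refine congr_arg sSup (Set.ext fun V ↦ ?_)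
  exact ⟨fun ⟨x⟩ ↦ ⟨e.hom.hom.app _ x⟩, fun ⟨x⟩ ↦ ⟨e.inv.hom.app _ x⟩⟩

lemma exists_loc_support_eq (V : X.Opens) :
    ∃ G : Loc (ZarTopos X), support (G : ZarTopos X) = V :=
  ⟨locMk (isSubterminal_openSheaf V),
    (support_congr (locMkIso (isSubterminal_openSheaf V))).trans (support_openSheaf V)⟩

/-- The direct image of the empty set under a point. -/
abbrev emptyImage (P : Point.{u} (ZarTopos X)) : ZarTopos X := P.direct.obj PEmpty

lemma isSubterminal_emptyImage (P : Point.{u} (ZarTopos X)) : IsSubterminal (emptyImage P) :=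
  P.isSubterminal_direct fun _ f _ ↦ by
    ext x
    exact (f x).elim

/-- A set is empty exactly when it maps to `∅`; by adjunction, maps `P⁻¹F ⟶ ∅` are maps `F ⟶ P_*∅`.
-/
lemma nonempty_inverse_iff (P : Point.{u} (ZarTopos X)) (F : ZarTopos X) :
    Nonempty (P.inverse.obj F) ↔ ¬ support F ≤ support (emptyImage P) := by
  rw [← nonempty_hom_iff_support_le (isSubterminal_emptyImage P),
    ← (P.adj.homEquiv F PEmpty).nonempty_congr, ← not_isEmpty_iff, not_iff_not]
  exact ⟨fun h ↦ ⟨↾fun x ↦ h.elim x⟩, fun ⟨f⟩ ↦ ⟨fun x ↦ (f x).elim⟩⟩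

/-- The generic point of the complement of the open set attached to `P` is the point of `X` at
which `P` is located. -/
lemma exists_location (P : Point.{u} (ZarTopos X)) :
    ∃ x : X, ∀ F : ZarTopos X, Nonempty (P.inverse.obj F) ↔ x ∈ support F := by
  set U := support (emptyImage P) with hU
  have hirr : IsIrreducible ((U : Set X)ᶜ) := by
    constructor
    · rw [Set.nonempty_compl]
      intro h
      have : Nonempty (P.inverse.obj (⊤_ (ZarTopos X))) :=
        have h := terminalIsTerminal.isTerminalObj P.inverse (⊤_ (ZarTopos X))
        ⟨(Types.isTerminalEquivUnique _ h).default⟩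
      rw [nonempty_inverse_iff] at this
      exact this fun x _ ↦ (Set.eq_univ_iff_forall.1 h) x
    · rintro A B hA hB ⟨a, ha, haA⟩ ⟨b, hb, hbB⟩
      have h₁ (V : X.Opens) (y : X) (hy : y ∈ (U : Set X)ᶜ) (hyV : y ∈ V) :
          Nonempty (P.inverse.obj (openSheaf V)) := by
        rw [nonempty_inverse_iff, support_openSheaf]
        exact fun h ↦ hy (h hyV)
      obtain ⟨s⟩ := h₁ ⟨A, hA⟩ a ha haA
      obtain ⟨t⟩ := h₁ ⟨B, hB⟩ b hb hbB
      -- Left exactness enters here: `P⁻¹` of the product is nonempty, so the support of the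
      -- product, contained in `A ∩ B`, meets the complement of `U`.
      let c : PUnit ⟶ P.inverse.obj (openSheaf ⟨A, hA⟩ ⨯ openSheaf ⟨B, hB⟩) :=
        prod.lift (↾fun _ ↦ s) (↾fun _ ↦ t) ≫ (PreservesLimitPair.iso P.inverse _ _).inv
      have h := (nonempty_inverse_iff P _).1 ⟨c PUnit.unit⟩
      obtain ⟨x, hx, hxU⟩ := SetLike.not_le_iff_exists.1 h
      have hx' (V : X.Opens) (f : openSheaf ⟨A, hA⟩ ⨯ openSheaf ⟨B, hB⟩ ⟶ openSheaf V) : x ∈ V := by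
        have := (nonempty_hom_iff_support_le (isSubterminal_openSheaf V)).1 ⟨f⟩ hx
        rwa [support_openSheaf] at this
      exact ⟨x, hxU, hx' _ prod.fst, hx' _ prod.snd⟩
  obtain ⟨x, hx⟩ := QuasiSober.sober hirr U.isOpen.isClosed_compl
  refine ⟨x, fun F ↦ ?_⟩
  rw [nonempty_inverse_iff]
  have h := hx.mem_open_set_iff (support F).isOpen
  rw [← hU]
  refine Iff.trans ?_ h.symm
  rw [SetLike.not_le_iff_exists]
  exact ⟨fun ⟨y, hy, hy'⟩ ↦ ⟨y, hy', hy⟩, fun ⟨y, hy', hy⟩ ↦ ⟨y, hy, hy'⟩⟩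

lemma nonempty_stalk_iff (x : X) (F : ZarTopos X) :
    Nonempty ((stalkPoint x).inverse.obj F) ↔ x ∈ support F := by
  constructor
  · rintro ⟨p⟩
    obtain ⟨V, ⟨⟨hV⟩⟩, z, -⟩ :=
      (Opens.pointGrothendieckTopology x).toPresheafFiber_jointly_surjective (P := F.obj) p
    exact TopologicalSpace.Opens.mem_sSup.2 ⟨V, ⟨z⟩, hV⟩
  · intro hx
    obtain ⟨V, ⟨z⟩, hV⟩ := TopologicalSpace.Opens.mem_sSup.1 hx
    exact ⟨(Opens.pointGrothendieckTopology x).toPresheafFiber V ⟨⟨hV⟩⟩ F.obj z⟩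

lemma exists_pointSpace_location (p : PointSpace.{u} (ZarTopos X)) :
    ∃ x : X, ∀ G : Loc (ZarTopos X), p ∈ PointSpace.basicOpen G ↔ x ∈ support (G : ZarTopos X) := by
  induction p using Quotient.inductionOn with
  | h P =>
    obtain ⟨x, hx⟩ := exists_location P
    exact ⟨x, fun G ↦ hx G⟩

-- Every open of `X` is the support of a subterminal sheaf, so the location map `g` induces the
-- topology of the point space, and the stalk points are a section of it.
variable (X) in
lemma exists_homeomorph_stalkPoint :
    ∃ h : X ≃ₜ Sobrification (PointSpace.{u} (ZarTopos X)),
      ∀ x : X, h x = toSobrification (PointSpace.mk (stalkPoint x)) := by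
  choose g hg using exists_pointSpace_location (X := X)
  refine exists_homeomorph_sobrification (g := g) ⟨?_⟩
    (s := fun x ↦ PointSpace.mk (stalkPoint x)) fun x ↦ ?_
  · have key (G : Loc (ZarTopos X)) :
        PointSpace.basicOpen G = g ⁻¹' (support (G : ZarTopos X) : Set X) :=
      Set.ext fun p ↦ hg p G
    refine le_antisymm (continuous_iff_le_induced.1 ⟨fun V hV ↦ ?_⟩) (le_generateFrom ?_)
    · obtain ⟨G, hG⟩ := exists_loc_support_eq ⟨V, hV⟩
      rw [show V = (support (G : ZarTopos X) : Set X) from congr_arg SetLike.coe hG.symm, ← key]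
      exact TopologicalSpace.isOpen_generateFrom_of_mem ⟨G, rfl⟩
    · rintro _ ⟨G, rfl⟩
      rw [key]
      exact ⟨_, (support (G : ZarTopos X)).isOpen, rfl⟩
  -- `X` is T0, so it suffices that the location of the stalk point lies in the same opens as `x`.
  · refine (inseparable_iff_forall_isOpen.2 fun V hV ↦ ?_).eq
    obtain ⟨G, hG⟩ := exists_loc_support_eq ⟨V, hV⟩
    have h₁ := hg (PointSpace.mk (stalkPoint x)) G
    have h₂ := nonempty_stalk_iff x G
    rw [hG] at h₁ h₂
    exact h₁.symm.trans h₂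

/-! ### Sheafification of presheaves that embed into a sheaf -/

section LocalEmbedding

open Opposite

variable {C : Type u₁} [Category.{v₁} C] (J : GrothendieckTopology C)

/-- An associated sheaf of a separated presheaf, over a site of arbitrary size. -/
structure AssociatedSheaf (P : Cᵒᵖ ⥤ Type w) where
  /-- the associated sheaf -/
  sheaf : Sheaf J (Type w)
  /-- the canonical map -/
  unit : P ⟶ sheaf.obj
  injective : ∀ U, Function.Injective (unit.app U)
  locally_surjective : ∀ {U : C} (s : sheaf.obj.obj (op U)), ∃ S ∈ J U,
    ∀ ⦃W : C⦄ (f : W ⟶ U), S f → ∃ t, unit.app (op W) t = sheaf.obj.map f.op s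
  bijective : ∀ F : Sheaf J (Type w), Function.Bijective fun f : sheaf ⟶ F ↦ unit ≫ f.hom

variable {J}

/-- The associated sheaf of a presheaf that embeds into a sheaf. -/
def AssociatedSheaf.ofMono {P Q : Cᵒᵖ ⥤ Type w} (hQ : Presieve.IsSheaf J Q) (j : P ⟶ Q) [Mono j] :
    AssociatedSheaf J P where
  -- These are the sections of `Q` that lie in the image of `j` on a covering sieve.
  sheaf := ⟨((Subfunctor.range j).sheafify J).toFunctor,
    (isSheaf_iff_isSheaf_of_type _ _).2 (Subfunctor.sheafify_isSheaf _ hQ)⟩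
  unit := Subfunctor.toRangeSheafify J j
  injective U := by
    have h : Function.Injective (j.app U) := by
      rw [← mono_iff_injective]
      infer_instance
    exact fun x y hxy ↦ h (congr_arg Subtype.val hxy)
  locally_surjective {U} s := by
    refine ⟨_, s.2, fun W f hf ↦ ?_⟩
    obtain ⟨t, ht⟩ := hf
    exact ⟨t, Subtype.ext ht⟩
  bijective F := by
    have hF := (isSheaf_iff_isSheaf_of_type _ _).1 F.property
    constructor
    · intro f g hfg
      refine ObjectProperty.hom_ext _ (Subfunctor.to_sheafify_lift_unique _ hF _ _ ?_)
      rw [← cancel_epi (Subfunctor.toRange j)]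
      exact hfg
    · intro f
      refine ⟨⟨Subfunctor.sheafifyLift _ (inv (Subfunctor.toRange j) ≫ f) hF⟩, ?_⟩
      change (Subfunctor.toRange j ≫ Subfunctor.homOfLe _) ≫ _ = f
      rw [Category.assoc, Subfunctor.to_sheafifyLift, IsIso.hom_inv_id_assoc]

end LocalEmbedding

/-! ### The inverse image of a Zariski sheaf -/

/-- The points of the étalé space of a Zariski sheaf. -/
abbrev EtalePoints (G : ZarTopos X) : Type u :=
  Σ x : X, (Opens.pointGrothendieckTopology x).presheafFiber.obj G.obj

/-- The germ of a section, as a point of the étalé space. -/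
def germPoint (G : ZarTopos X) {V : X.Opens} (x : X) (hx : x ∈ V)
    (s : G.obj.obj (Opposite.op V)) : EtalePoints G :=
  ⟨x, (Opens.pointGrothendieckTopology x).toPresheafFiber V ⟨⟨hx⟩⟩ G.obj s⟩

lemma germPoint_map (G : ZarTopos X) {V W : X.Opens} (f : W ⟶ V) (x : X) (hx : x ∈ W)
    (s : G.obj.obj (Opposite.op V)) :
    germPoint G x hx (G.obj.map f.op s) = germPoint G x (f.le hx) s :=
  congr_arg (Sigma.mk x)
    ((Opens.pointGrothendieckTopology x).toPresheafFiber_w_apply f ⟨⟨hx⟩⟩ G.obj s)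

lemma exists_map_eq_of_germPoint_eq (G : ZarTopos X) {V : X.Opens} (x : X) (hx : x ∈ V)
    (s t : G.obj.obj (Opposite.op V)) (h : germPoint G x hx s = germPoint G x hx t) :
    ∃ (W : X.Opens) (f : W ⟶ V), x ∈ W ∧ G.obj.map f.op s = G.obj.map f.op t := by
  obtain ⟨W, f, ⟨⟨hW⟩⟩, -, h⟩ :=
    ((Opens.pointGrothendieckTopology x).toPresheafFiber_eq_iff' (P := G.obj) V ⟨⟨hx⟩⟩ s t).1
      (eq_of_heq (Sigma.mk.inj h).2)
  exact ⟨W, f, hW, h⟩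

/-- The presheaf of arbitrary functions with values in a set. -/
def functionPresheaf (X : Scheme.{u}) (A : Type u) : (FppfSite X)ᵒᵖ ⥤ Type u where
  obj U := U.unop.left → A
  map f := ↾fun s w ↦ s (f.unop.left w)

/-- Functions glue along jointly surjective families: points `w` and `v` with the same image lift to
a common point of the fiber product, so compatible functions agree there. -/
lemma isSheaf_functionPresheaf (A : Type u) :
    Presieve.IsSheaf (fppfTopology X) (functionPresheaf X A) := by
  intro U S hS x hx
  rw [mem_fppfTopology_iff] at hS
  choose W f hf hflat w hw using hS
  refine ⟨fun y ↦ x (f y) (hf y) (w y), fun V g hg ↦ funext fun v ↦ ?_, fun t ht ↦ funext fun y ↦ ?_⟩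
  · obtain ⟨z, hz, hz'⟩ := exists_fiberProduct (f (g.left v)) g (w (g.left v)) v (hw _)
    have h := congr_fun (hx (fiberProductFst (f (g.left v)) g) (fiberProductSnd (f (g.left v)) g)
      (hf _) hg (fiberProduct_condition _ _)) z
    refine (congr_arg (x (f (g.left v)) (hf _)) hz).symm.trans (Eq.trans h ?_)
    exact congr_arg (x g hg) hz'
  · refine (congr_arg t (hw y)).symm.trans ?_
    exact congr_fun (ht (f y) (hf y)) (w y)

/-- The map that sends a section over `p(U)` to its germs at the points of `U`. -/
def germMap (G : ZarTopos X) :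
    (imageFunctor X).op ⋙ G.obj ⟶ functionPresheaf X (EtalePoints G) where
  app U := ↾fun s y ↦ germPoint G (U.unop.hom y) (hom_mem_imageFunctor_obj U.unop y) s
  naturality U W f := by
    ext s
    funext w
    have h (x x' : X) (hxx' : x = x') (hx : x ∈ (imageFunctor X).obj U.unop)
        (hx' : x' ∈ (imageFunctor X).obj U.unop) : germPoint G x hx s = germPoint G x' hx' s := by
      subst hxx'
      rfl
    exact (germPoint_map G ((imageFunctor X).map f.unop) _ _ s).trans
      (h _ _ (hom_left_apply f.unop w).symm _ _)

/-- A section over `p(U)` is determined by its germs, and every point of `p(U)` is the image of a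
point of `U`. -/
instance (G : ZarTopos X) : Mono (germMap G) := by
  rw [NatTrans.mono_iff_mono_app]
  intro U
  rw [mono_iff_injective]
  intro s t hst
  have hG := (isSheaf_iff_isSheaf_of_type _ _).1 G.property
  have hcov : ∀ x ∈ (imageFunctor X).obj U.unop, ∃ (W : X.Opens)
      (f : W ⟶ (imageFunctor X).obj U.unop), G.obj.map f.op s = G.obj.map f.op t ∧ x ∈ W := by
    rintro _ ⟨y, rfl⟩
    obtain ⟨W, f, hW, h⟩ := exists_map_eq_of_germPoint_eq G _ _ s t (congr_fun hst y)
    exact ⟨W, f, h, hW⟩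
  let S : Sieve ((imageFunctor X).obj U.unop) :=
    { arrows W f := G.obj.map f.op s = G.obj.map f.op t
      downward_closed {W W' f} h g := by
        simp only [op_comp, Functor.map_comp, comp_apply, h] }
  exact (hG.isSeparated S hcov).ext fun W f hf ↦ hf

/-- The inverse image of a Zariski sheaf. -/
def inverseImage (G : ZarTopos X) :
    AssociatedSheaf (fppfTopology X) ((imageFunctor X).op ⋙ G.obj) :=
  .ofMono (isSheaf_functionPresheaf _) (germMap G)

variable (X) in
/-- The direct image functor. -/
abbrev directImage : FppfTopos X ⥤ ZarTopos X :=
  (inclusionFunctor X).sheafPushforwardContinuous (Type u) (Opens.grothendieckTopology X)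
    (fppfTopology X)

/-- The universal property of the inverse image. -/
def inverseImageHomEquiv (G : ZarTopos X) (F : FppfTopos X) :
    ((inverseImage G).sheaf ⟶ F) ≃ (G ⟶ (directImage X).obj F) :=
  (Equiv.ofBijective _ ((inverseImage G).bijective F)).trans <|
    (((imageInclusionAdjunction X).op.whiskerLeft (Type u)).homEquiv G.obj F.obj).trans
      ((fullyFaithfulSheafToPresheaf _ _).homEquiv (X := G) (Y := (directImage X).obj F)).symm

lemma inverseImageHomEquiv_naturality_right (G : ZarTopos X) (F F' : FppfTopos X) (g : F ⟶ F')
    (h : (inverseImage G).sheaf ⟶ F) : inverseImageHomEquiv G F' (h ≫ g) =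
      inverseImageHomEquiv G F h ≫ (directImage X).map g := by
  refine ObjectProperty.hom_ext _ ?_
  exact (((imageInclusionAdjunction X).op.whiskerLeft (Type u)).homEquiv_naturality_right
    ((inverseImage G).unit ≫ h.hom) g.hom)

variable (X) in
/-- The inverse image functor. -/
def inverseImageFunctor : ZarTopos X ⥤ FppfTopos X :=
  Adjunction.leftAdjointOfEquiv inverseImageHomEquiv inverseImageHomEquiv_naturality_right

variable (X) in
/-- The inverse image functor is left adjoint to the direct image functor. -/
def inverseDirectAdjunction : inverseImageFunctor X ⊣ directImage X :=
  Adjunction.adjunctionOfEquivLeft inverseImageHomEquiv inverseImageHomEquiv_naturality_right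

/-- The action on morphisms is defined through the adjunction; transposing along `u ⊣ v` shows that
it extends the evident map on `U ↦ G(p(U))`. -/
lemma unit_inverseImageFunctor_map {G H : ZarTopos X} (f : G ⟶ H) :
    (inverseImage G).unit ≫ ((inverseImageFunctor X).map f).hom =
      Functor.whiskerLeft (imageFunctor X).op f.hom ≫ (inverseImage H).unit := by
  let adj := (imageInclusionAdjunction X).op.whiskerLeft (Type u)
  have h : inverseImageHomEquiv G _ ((inverseImageFunctor X).map f) =
      f ≫ inverseImageHomEquiv H _ (𝟙 _) := Equiv.apply_symm_apply _ _
  refine (adj.homEquiv G.obj (inverseImage H).sheaf.obj).injective ?_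
  have h' : adj.homEquiv G.obj (inverseImage H).sheaf.obj
      ((inverseImage G).unit ≫ ((inverseImageFunctor X).map f).hom) =
      f.hom ≫ adj.homEquiv H.obj (inverseImage H).sheaf.obj ((inverseImage H).unit ≫ 𝟙 _) :=
    congr_arg (fun a ↦ a.hom) h
  rw [Category.comp_id] at h'
  exact h'.trans (adj.homEquiv_naturality_left f.hom (inverseImage H).unit).symm

/-! ### Exactness of the inverse image -/

section Exactness

open Opposite

/-- The sections of the inverse image of `G` over `U`. -/
def InverseSections (G : ZarTopos X) (U : FppfSite X) : Type u :=
  ((inverseImageFunctor X).obj G).obj.obj (op U)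

namespace InverseSections

/-- The section given by a section of `G` over `p(U)`. -/
def unit (G : ZarTopos X) (U : FppfSite X) (s : G.obj.obj (op ((imageFunctor X).obj U))) :
    InverseSections G U :=
  (inverseImage G).unit.app (op U) s

/-- Restriction of sections. -/
def res (G : ZarTopos X) {U W : FppfSite X} (g : W ⟶ U) (s : InverseSections G U) :
    InverseSections G W :=
  ((inverseImageFunctor X).obj G).obj.map g.op s

/-- The action of a morphism of sheaves on sections. -/
def map {G H : ZarTopos X} (f : G ⟶ H) (U : FppfSite X) (s : InverseSections G U) :
    InverseSections H U :=
  ((inverseImageFunctor X).map f).hom.app (op U) s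

lemma unit_injective (G : ZarTopos X) (U : FppfSite X) : Function.Injective (unit G U) :=
  (inverseImage G).injective _

lemma map_unit {G H : ZarTopos X} (f : G ⟶ H) (U : FppfSite X)
    (s : G.obj.obj (op ((imageFunctor X).obj U))) :
    map f U (unit G U s) = unit H U (f.hom.app _ s) :=
  ConcreteCategory.congr_hom (congr_app (unit_inverseImageFunctor_map f) (op U)) s

lemma res_map {G H : ZarTopos X} (f : G ⟶ H) {U W : FppfSite X} (g : W ⟶ U)
    (s : InverseSections G U) : res H g (map f U s) = map f W (res G g s) :=
  (ConcreteCategory.congr_hom (((inverseImageFunctor X).map f).hom.naturality g.op) s).symm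

lemma res_res (G : ZarTopos X) {U W Z : FppfSite X} (g : W ⟶ U) (h : Z ⟶ W)
    (s : InverseSections G U) : res G h (res G g s) = res G (h ≫ g) s :=
  (ConcreteCategory.congr_hom
    (((inverseImageFunctor X).obj G).obj.map_comp g.op h.op) s).symm

lemma isSheaf (G : ZarTopos X) :
    Presieve.IsSheaf (fppfTopology X) ((inverseImageFunctor X).obj G).obj :=
  (isSheaf_iff_isSheaf_of_type _ _).1 ((inverseImageFunctor X).obj G).property

lemma ext_of_mem (G : ZarTopos X) {U : FppfSite X} {S : Sieve U} (hS : S ∈ fppfTopology X U)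
    (s t : InverseSections G U) (h : ∀ ⦃W : FppfSite X⦄ (f : W ⟶ U), S f → res G f s = res G f t) :
    s = t :=
  ((isSheaf G).isSeparated S hS).ext h

lemma exists_glue (G : ZarTopos X) {U : FppfSite X} {S : Sieve U} (hS : S ∈ fppfTopology X U)
    (x : ∀ ⦃W : FppfSite X⦄ (f : W ⟶ U), S f → InverseSections G W)
    (hx : ∀ ⦃W₁ W₂ Z : FppfSite X⦄ (g₁ : Z ⟶ W₁) (g₂ : Z ⟶ W₂) ⦃f₁ : W₁ ⟶ U⦄ ⦃f₂ : W₂ ⟶ U⦄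
      (h₁ : S f₁) (h₂ : S f₂), g₁ ≫ f₁ = g₂ ≫ f₂ → res G g₁ (x f₁ h₁) = res G g₂ (x f₂ h₂)) :
    ∃ y : InverseSections G U, ∀ ⦃W : FppfSite X⦄ (f : W ⟶ U) (hf : S f), res G f y = x f hf := by
  obtain ⟨y, hy, -⟩ := isSheaf G S hS x hx
  exact ⟨y, hy⟩

lemma exists_unit_eq (G : ZarTopos X) {U : FppfSite X} (s : InverseSections G U) :
    ∃ S ∈ fppfTopology X U, ∀ ⦃W : FppfSite X⦄ (f : W ⟶ U), S f →
      ∃ t, unit G W t = res G f s :=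
  (inverseImage G).locally_surjective s

end InverseSections

lemma finset_inf_mem {C : Type u₁} [Category.{v₁} C] (J : GrothendieckTopology C) {ι : Type*}
    {U : C} (s : Finset ι) (S : ι → Sieve U) (hS : ∀ i, S i ∈ J U) : s.inf S ∈ J U := by
  classical
  induction s using Finset.induction with
  | empty => exact J.top_mem U
  | insert i s _ ih =>
    rw [Finset.inf_insert]
    exact J.intersection_covering (hS i) ih

variable {K : Type} [SmallCategory K] {D : K ⥤ ZarTopos X} {P : ZarTopos X}
  {π : ∀ k, P ⟶ D.obj k}

open InverseSections

/-- On a common covering sieve both sections come from `P(p(W))`, where `H` gives uniqueness;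
injectivity of `unit` carries the equalities down to that level. -/
lemma inverseSections_ext (hπ : ∀ ⦃k l : K⦄ (a : k ⟶ l), π k ≫ D.map a = π l)
    (H : ∀ (V : X.Opens) (t : ∀ k, (D.obj k).obj.obj (op V)),
      (∀ ⦃k l : K⦄ (a : k ⟶ l), (D.map a).hom.app (op V) (t k) = t l) →
        ∃! x : P.obj.obj (op V), ∀ k, (π k).hom.app (op V) x = t k)
    {U : FppfSite X} (x y : InverseSections P U) (h : ∀ k, map (π k) U x = map (π k) U y) :
    x = y := by
  obtain ⟨S, hS, hSx⟩ := exists_unit_eq P x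
  obtain ⟨T, hT, hTy⟩ := exists_unit_eq P y
  refine ext_of_mem P ((fppfTopology X).intersection_covering hS hT) _ _ fun W f hf ↦ ?_
  obtain ⟨a, ha⟩ := hSx f hf.1
  obtain ⟨b, hb⟩ := hTy f hf.2
  rw [← ha, ← hb]
  refine congr_arg _ ((H _ (fun k ↦ (π k).hom.app _ b) fun k l g ↦ ?_).unique (fun k ↦ ?_)
    fun _ ↦ rfl)
  · rw [← hπ g]
    rfl
  · refine unit_injective _ _ ?_
    rw [← map_unit, ← map_unit, ha, hb, ← res_map, ← res_map, h]

lemma existsUnique_inverseSections [FinCategory K]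
    (hπ : ∀ ⦃k l : K⦄ (a : k ⟶ l), π k ≫ D.map a = π l)
    (H : ∀ (V : X.Opens) (t : ∀ k, (D.obj k).obj.obj (op V)),
      (∀ ⦃k l : K⦄ (a : k ⟶ l), (D.map a).hom.app (op V) (t k) = t l) →
        ∃! x : P.obj.obj (op V), ∀ k, (π k).hom.app (op V) x = t k)
    {U : FppfSite X} (s : ∀ k, InverseSections (D.obj k) U)
    (hs : ∀ ⦃k l : K⦄ (a : k ⟶ l), map (D.map a) U (s k) = s l) :
    ∃! x : InverseSections P U, ∀ k, map (π k) U x = s k := by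
  choose S hS hSs using fun k ↦ exists_unit_eq (D.obj k) (s k)
  -- Finiteness of `K` is used here: one covering sieve must lift all the `s k` at once.
  have hT := finset_inf_mem (fppfTopology X) Finset.univ S hS
  set T := Finset.univ.inf S
  have hTS (k : K) : T ≤ S k := Finset.inf_le (Finset.mem_univ k)
  have hloc ⦃W : FppfSite X⦄ (f : W ⟶ U) (hf : T f) :
      ∃ x : InverseSections P W, ∀ k, map (π k) W x = res (D.obj k) f (s k) := by
    choose t ht using fun k ↦ hSs k f (hTS k _ hf)
    obtain ⟨x, hx, -⟩ := H _ t fun k l a ↦ by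
      refine unit_injective _ _ ?_
      rw [← map_unit, ht, ht, ← res_map, hs]
    exact ⟨unit P W x, fun k ↦ by rw [map_unit, hx, ht]⟩
  choose x hx using hloc
  obtain ⟨y, hy⟩ := exists_glue P hT x fun W₁ W₂ Z g₁ g₂ f₁ f₂ h₁ h₂ h ↦ by
    refine inverseSections_ext hπ H _ _ fun k ↦ ?_
    rw [← res_map, ← res_map, hx, hx, res_res, res_res, h]
  have hy' (k : K) : map (π k) U y = s k :=
    ext_of_mem _ hT _ _ fun W f hf ↦ by rw [res_map, hy f hf, hx]
  exact ⟨y, hy', fun z hz ↦ inverseSections_ext hπ H _ _ fun k ↦ (hz k).trans (hy' k).symm⟩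

end Exactness

/-- Limits of sheaves are computed on sections, on both sites, so the claim reduces to unique
existence of sections. -/
instance : PreservesFiniteLimits (inverseImageFunctor X) where
  preservesFiniteLimits K _ _ := ⟨fun {D} ↦ ⟨fun {c} hc ↦ by
    refine ⟨isLimitOfReflects (sheafToPresheaf _ (Type u))
      (evaluationJointlyReflectsLimits _ fun U ↦ ?_)⟩
    refine ((Types.isLimit_iff _).2 fun s hs ↦ ?_).some
    refine existsUnique_inverseSections (D := D) (P := c.pt) (π := c.π.app)
      (fun _ _ a ↦ c.w a) (fun V t ht ↦ ?_) (U := U.unop) s fun _ _ a ↦ hs a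
    exact (Types.isLimit_iff
      ((sheafToPresheaf _ (Type u) ⋙ (evaluation _ _).obj (Opposite.op V)).mapCone c)).1
        ⟨isLimitOfPreserves _ hc⟩ t fun a ↦ ht a⟩⟩

variable (X) in
/-- The continuous map of topoi from the fppf topos to the Zariski topos. -/
def fppfToZar : ToposMap (FppfTopos X) (ZarTopos X) where
  direct := directImage X
  inverse := inverseImageFunctor X
  adj := inverseDirectAdjunction X
  preservesFiniteLimits := inferInstance

/-! ### The continuous map of locales and the space of points of the fppf topos -/

/-- The composite with the monomorphism `V.ι` is the flat structure morphism, and a property stable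
under base change cancels monomorphisms on the right. -/
lemma flat_toInclusion {U : FppfSite X} {V : X.Opens} (h : (imageFunctor X).obj U ≤ V) :
    Flat (toInclusion h).left := by
  have h₁ : Flat (toInclusionLeft h ≫ V.ι) := by
    rw [show toInclusionLeft h ≫ V.ι = (U.hom : U.left ⟶ X) from IsOpenImmersion.lift_fac _ _ _]
    exact flat_hom U
  have : MorphismProperty.HasOfPostcompProperty @Flat (.monomorphisms Scheme.{u}) :=
    MorphismProperty.IsStableUnderBaseChange.hasOfPostcompProperty_monomorphisms (P := @Flat)
  exact MorphismProperty.of_postcomp (W := @Flat) (W' := .monomorphisms Scheme.{u})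
    (toInclusionLeft h) V.ι (inferInstanceAs (Mono V.ι)) h₁

/-- The single arrow `U ⟶ p(U)` is flat and surjective, so a section over `U` descends. -/
lemma nonempty_sections_image {F : FppfTopos X} (hF : IsSubterminal F) {U : FppfSite X}
    (h : Nonempty (F.obj.obj (Opposite.op U))) :
    Nonempty (((directImage X).obj F).obj.obj (Opposite.op ((imageFunctor X).obj U))) := by
  let S : Sieve ((inclusionFunctor X).obj ((imageFunctor X).obj U)) :=
    { arrows W _ := Nonempty (F.obj.obj (Opposite.op W))
      downward_closed {_ _ _} hW g := hW.map (F.obj.map g.op) }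
  refine nonempty_sections_of_mem hF (S := S) ?_ fun _ _ hf ↦ hf
  rw [mem_fppfTopology_iff]
  rintro ⟨_, y, rfl⟩
  refine ⟨U, toInclusion le_rfl, h, flat_toInclusion _, y, ?_⟩
  apply ((imageFunctor X).obj U).ι.isOpenEmbedding.injective
  exact hom_left_apply (toInclusion (le_refl ((imageFunctor X).obj U))) y

/-- Locally on `U` the section comes from `G(p(W))`, and the opens `p(W)` cover `p(U)`. -/
lemma nonempty_of_inverseSections {G : ZarTopos X} (hG : IsSubterminal G) {U : FppfSite X}
    (h : Nonempty (InverseSections G U)) :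
    Nonempty (G.obj.obj (Opposite.op ((imageFunctor X).obj U))) := by
  obtain ⟨s⟩ := h
  obtain ⟨S, hS, hSs⟩ := InverseSections.exists_unit_eq G s
  rw [mem_fppfTopology_iff] at hS
  let T : Sieve ((imageFunctor X).obj U) :=
    { arrows W _ := Nonempty (G.obj.obj (Opposite.op W))
      downward_closed {_ _ _} hW g := hW.map (G.obj.map g.op) }
  refine nonempty_sections_of_mem hG (S := T) ?_ fun _ _ hf ↦ hf
  rintro _ ⟨y, rfl⟩
  obtain ⟨W, f, hf, -, w, rfl⟩ := hS y
  obtain ⟨t, -⟩ := hSs f hf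
  refine ⟨(imageFunctor X).obj W, (imageFunctor X).map f, ⟨t⟩, ?_⟩
  rw [hom_left_apply]
  exact hom_mem_imageFunctor_obj W w

lemma locMap_fppfToZar_le_iff {G H : Loc (ZarTopos X)} :
    (fppfToZar X).locMap G ≤ (fppfToZar X).locMap H ↔ G ≤ H := by
  refine ⟨fun h ↦ ?_, fun h ↦ (fppfToZar X).locMap.monotone h⟩
  obtain ⟨f⟩ := loc_le_iff.1 h
  have f' := (fppfToZar X).adj.homEquiv _ _
    (((fppfToZar X).locMapIso G).inv ≫ f ≫ ((fppfToZar X).locMapIso H).hom)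
  rw [loc_le_iff, nonempty_hom_iff (isSubterminal_loc H)]
  rintro ⟨V⟩ ⟨s⟩
  have := nonempty_of_inverseSections (isSubterminal_loc H)
    (U := (inclusionFunctor X).obj V) ⟨f'.hom.app _ s⟩
  rwa [imageFunctor_obj_inclusionFunctor_obj] at this

/-- The preimage of `K` is `ε_*K`. The counit gives one inequality; for the other, a section of `K`
over `U` descends to `p(U)` and returns through `unit`. -/
lemma locMap_fppfToZar_surjective : Function.Surjective (fppfToZar X).locMap := by
  intro K
  have hK := (fppfToZar X).isSubterminal_direct (isSubterminal_loc K)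
  refine ⟨locMk hK, le_antisymm (loc_le_iff.2 ⟨?_⟩) (loc_le_iff.2 ?_)⟩
  · exact ((fppfToZar X).locMapIso _).hom ≫ (fppfToZar X).inverse.map (locMkIso hK).hom ≫
      (fppfToZar X).adj.counit.app _
  · rw [nonempty_hom_iff (isSubterminal_loc _)]
    rintro ⟨U⟩ h
    obtain ⟨s⟩ := nonempty_sections_image (isSubterminal_loc K) h
    exact ⟨((fppfToZar X).locMapIso (locMk hK)).inv.hom.app _
      (InverseSections.unit _ U ((locMkIso hK).inv.hom.app _ s))⟩

variable (X) in
/-- The isomorphism of locales between the fppf topos and the Zariski topos. -/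
def locIso : Loc (ZarTopos X) ≃o Loc (FppfTopos X) :=
  RelIso.ofSurjective (OrderEmbedding.ofMapLEIff (fppfToZar X).locMap
    fun _ _ ↦ locMap_fppfToZar_le_iff) locMap_fppfToZar_surjective

/-- A continuous map of topoi that is surjective on opens of locales induces the topology on
spaces of points. -/
lemma isInducing_pointMap {E : Type u₁} [Category.{v₁} E] {E' : Type u₂} [Category.{v₂} E']
    [HasTerminal E] [HasTerminal E'] (f : ToposMap E E') (hf : Function.Surjective f.locMap) :
    Topology.IsInducing f.pointMap.{u} := by
  refine ⟨le_antisymm (continuous_iff_le_induced.1 f.continuous_pointMap) (le_generateFrom ?_)⟩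
  rintro _ ⟨K, rfl⟩
  obtain ⟨G, rfl⟩ := hf K
  rw [← f.preimage_basicOpen]
  exact ⟨_, TopologicalSpace.isOpen_generateFrom_of_mem ⟨G, rfl⟩, rfl⟩

variable (X) in
lemma isEmbedding_sobrificationMap_fppfToZar :
    Topology.IsEmbedding (sobrificationMap (fppfToZar X).pointMap.{u}
      (fppfToZar X).continuous_pointMap) :=
  isEmbedding_sobrificationMap (isInducing_pointMap (fppfToZar X) locMap_fppfToZar_surjective)

end FppfPoints

end

theorem mainTheorem10 (X : Scheme.{u}) :
    -- the functors `(U, p) ↦ p(U)` and `V ↦ (V, i)` are adjoint and satisfy (TL 1) -- (TL 4)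
    Nonempty (FppfPoints.imageFunctor X ⊣ FppfPoints.inclusionFunctor X) ∧
    FppfPoints.TLConditions.{w} (FppfPoints.fppfCoverings X) (FppfPoints.zarCoverings X)
      (FppfPoints.imageFunctor X) (FppfPoints.inclusionFunctor X) ∧
    -- `u` is cocontinuous, and induces `ε : X_fppf ⟶ X_Zar`, with `Γ(V, ε_* F) = Γ((V, i), F)`
    (FppfPoints.imageFunctor X).IsCocontinuous
      (FppfPoints.fppfTopology X) (Opens.grothendieckTopology X) ∧
    ∃ ε : FppfPoints.ToposMap (FppfPoints.FppfTopos X) (FppfPoints.ZarTopos X),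
      Nonempty (ε.direct ⋙ sheafToPresheaf _ (Type u) ≅
        sheafToPresheaf _ (Type u) ⋙
          (Functor.whiskeringLeft _ _ (Type u)).obj (FppfPoints.inclusionFunctor X).op) ∧
      -- the induced continuous map of locales is a homeomorphism
      (∃ φ : FppfPoints.Loc (FppfPoints.ZarTopos X) ≃o FppfPoints.Loc (FppfPoints.FppfTopos X),
        ∀ G, φ G = ε.locMap G) ∧
      -- `X = |X_Zar|_sob` via stalks, and `|X_fppf|_sob → |X_Zar|_sob = X` is an embedding
      ∃ h : X ≃ₜ FppfPoints.Sobrification (FppfPoints.PointSpace.{u} (FppfPoints.ZarTopos X)),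
        (∀ x : X, h x = FppfPoints.toSobrification
          (FppfPoints.PointSpace.mk (FppfPoints.stalkPoint x))) ∧
        Topology.IsEmbedding (fun C ↦
          h.symm (FppfPoints.sobrificationMap ε.pointMap ε.continuous_pointMap C)) := by
  obtain ⟨h, hh⟩ := FppfPoints.exists_homeomorph_stalkPoint X
  exact ⟨⟨FppfPoints.imageInclusionAdjunction X⟩, FppfPoints.tlConditions X, inferInstance,
    FppfPoints.fppfToZar X, ⟨Iso.refl _⟩, ⟨FppfPoints.locIso X, fun _ ↦ rfl⟩, h, hh,
    h.symm.isEmbedding.comp (FppfPoints.isEmbedding_sobrificationMap_fppfToZar X)⟩
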